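/- Graphs are finite and may have loops and multiple edges; each edge consists of two half-edges, each incident with one end of the edge (so a loop contributes two half-edges at its vertex). Let $(G,\sigma)$ be a signed graph, i.e. a graph $G$ with a signature $\sigma\colon E(G)\to\{1,-1\}$, and let $\tau$ be an orientation of it, i.e. a map $\tau\colon H(G)\to\{1,-1\}$ on the set $H(G)$ of half-edges with $\tau(h_1)\tau(h_2)=-\sigma(e)$ whenever $h_1,h_2$ are the two half-edges of an edge $e$. For $f\colon E(G)\to\mathbb Z$ and $v\in V(G)$ put $\partial f(v)=\sum_{h\in H(v)} f(e_h)\tau(h)$, where $H(v)$ is the set of half-edges incident with $v$ and $e_h$ is the edge containing $h$. For a positive integer $k$, the map $f$ is an integer-valued $k$-flow (respectively a modulo $k$-flow) if $|f(e)|\le k-1$ for every edge $e$ and $\partial f(v)=0$ (respectively $\partial f(v)\equiv 0 \pmod k$) for every vertex $v$. Let $\operatorname{supp}(f)=\{e\in E(G)\colon f(e)\ne 0\}$. An edge is a bridge if deleting it increases the number of components, and $G$ is bridgeless if it has no bridge. Theorem. If $G$ is bridgeless and $(G,\sigma)$ admits a modulo $3$-flow $f_1$, then it also admits an integer-valued $4$-flow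 $f_2$ (with respect to the same orientation) such that $$\operatorname{supp}(f_1)\subseteq\{e\in E(G)\colon f_2(e)\in\{1,-1,2,-2\}\}.$$ -/

import Mathlib

open scoped Graph

/-- The number of connected components of a multigraph: the number of classes of vertices under
the equivalence relation generated by adjacency. -/
noncomputable def Graph.numComponents {V E : Type*} (G : Graph V E) : ℕ :=
  Nat.card (Quot fun x y : V(G) => G.Adj x y)

/-- An edge is a bridge if deleting it increases the number of components. -/
def Graph.IsBridge {V E : Type*} (G : Graph V E) (e : E) : Prop :=
  e ∈ E(G) ∧ G.numComponents < (G.deleteEdges {e}).numComponents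

/-- A multigraph is bridgeless if it contains no bridges. -/
def Graph.IsBridgeless {V E : Type*} (G : Graph V E) : Prop :=
  ∀ e, ¬ G.IsBridge e

/-- A signed graph with vertex set `V` and edge set `E`; loops and parallel edges are allowed.
Every edge `e` consists of the two half-edges `(e, false)` and `(e, true)`, and each half-edge `h`
is incident with exactly one vertex `inc h` (the two half-edges of a loop are incident with the
same vertex). Every edge carries a sign `1` or `-1`. -/
structure SignedGraph (V E : Type*) where
  /-- The vertex incident with a half-edge. -/
  inc : E × Bool → V
  /-- The signature. -/
  sign : E → ℤˣ

namespace SignedGraph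

variable {V E : Type*}

/-- The underlying multigraph of a signed graph. -/
def toGraph (G : SignedGraph V E) : Graph V E where
  vertexSet := Set.univ
  edgeSet := Set.univ
  IsLink e x y := s(G.inc (e, false), G.inc (e, true)) = s(x, y)
  isLink_symm _ _ := ⟨fun x y h => h.trans Sym2.eq_swap⟩
  eq_or_eq_of_isLink_of_isLink e x y v w h h' := by
    have h2 := h.symm.trans h'
    rw [Sym2.eq_iff] at h2
    tauto
  edge_mem_iff_exists_isLink e := ⟨fun _ => ⟨_, _, rfl⟩, fun _ => Set.mem_univ e⟩
  left_mem_of_isLink _ _ _ _ := Set.mem_univ _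

/-- An orientation assigns `1` or `-1` to every half-edge, such that the product of the values on
the two half-edges of an edge is the negative of the sign of that edge. -/
def IsOrientation (G : SignedGraph V E) (τ : E × Bool → ℤˣ) : Prop :=
  ∀ e, τ (e, false) * τ (e, true) = -G.sign e

/-- The boundary of `f` at `v`: the sum of `f(e_h) τ(h)` over the half-edges `h` at `v`, where
`e_h` is the edge containing `h`. -/
def boundary [Fintype E] [DecidableEq V] (G : SignedGraph V E) (τ : E × Bool → ℤˣ) (f : E → ℤ)
    (v : V) : ℤ :=
  ∑ h : E × Bool with G.inc h = v, f h.1 * (τ h : ℤ)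

/-- `f` is an integer-valued `k`-flow of `G` with respect to the orientation `τ`. -/
def IsIntegerFlow [Fintype E] [DecidableEq V] (G : SignedGraph V E) (τ : E × Bool → ℤˣ) (k : ℕ)
    (f : E → ℤ) : Prop :=
  (∀ e, |f e| ≤ (k : ℤ) - 1) ∧ ∀ v, G.boundary τ f v = 0

/-- `f` is a modulo `k`-flow of `G` with respect to the orientation `τ`. -/
def IsModuloFlow [Fintype E] [DecidableEq V] (G : SignedGraph V E) (τ : E × Bool → ℤˣ) (k : ℕ)
    (f : E → ℤ) : Prop :=
  (∀ e, |f e| ≤ (k : ℤ) - 1) ∧ ∀ v, G.boundary τ f v ≡ 0 [ZMOD k]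

end SignedGraph

/-!
The signs of the edges play no role: only the signed values at half-edges matter. Replace `f₁` by
its representatives `±1` modulo `3` on its support, and replace every edge with value `0` by two
parallel copies with values `1` and `-1`. This gives a flow modulo `3` with all values `±1` on a
multigraph that is still bridgeless; its boundary is `3 * d`. If `S` is a set of edges on which the
boundary is `d`, then changing each value `g` on `S` to `-2 * g` makes the boundary zero. An
original edge of the support has value `±1` or `±2`, and merging the two copies of a zero edge gives
`0` or `±3`.

If every vertex has degree `3` and equal values at its half-edges, the sets `S` are the perfect
matchings, which exist by Petersen's theorem. The general case is
`exists_labelled_factor`. It is reduced by subdivision to `exists_factor_of_no_bridge`, on factors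
of bridgeless multigraphs with a fractional factor whose values are `1 / 3` and `2 / 3`. There a
gadget turns the factor into a perfect matching, and Tutte's theorem applies in the form
`exists_exactCover_of_fractional`, because every odd cut has weight at least `1`: an odd set that
separates the internal vertices of some gadget has that much weight in this gadget alone, and the
cut of any other odd set is an odd number of thirds, where one third would come from a bridge
(`three_le_gadget_cut`).
-/

/-! ### Perfect matchings from fractional ones -/

/-- A multigraph given by its list of edges `i`, with ends `s i ≠ t i`, has a perfect matching `m`
as soon as it has a fractional perfect matching `w` that gives weight at least `1` to every cut of
an odd vertex set. By Tutte's theorem it suffices to note that after deleting `u` each odd component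
receives weight at least `1`, all of it from `u`, whose vertices have total weight `|u|`. -/
theorem exists_exactCover_of_fractional {W I : Type*} [Fintype W] [DecidableEq W] [Fintype I]
    (s t : I → W) (hst : ∀ i, s i ≠ t i) (w : I → ℚ) (hw₀ : ∀ i, 0 ≤ w i)
    (hw : ∀ a, ∑ i, ((if s i = a then w i else 0) + if t i = a then w i else 0) = 1)
    (hcut : ∀ C : Set W, Odd C.ncard → 1 ≤ ∑ i, open Classical in
      if (s i ∈ C ↔ t i ∈ C) then 0 else w i) :
    ∃ m : I → ℕ, ∀ a, ∑ i, ((if s i = a then m i else 0) + if t i = a then m i else 0) = 1 := by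
  classical
  let G : SimpleGraph W :=
    { Adj a b := a ≠ b ∧ ∃ i, s(s i, t i) = s(a, b)
      symm := ⟨fun a b ⟨h, i, hi⟩ => ⟨h.symm, i, hi.trans Sym2.eq_swap⟩⟩
      loopless := ⟨fun a h => h.1 rfl⟩ }
  have hG : ∀ i, G.Adj (s i) (t i) := fun i => ⟨hst i, i, rfl⟩
  have htutte : ∀ u, ¬ G.IsTutteViolator u := by
    intro u hu
    let D := ((⊤ : G.Subgraph).deleteVerts u).coe
    change u.ncard < D.oddComponents.ncard at hu
    let S : D.ConnectedComponent → Set W := fun c => Subtype.val '' c.supp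
    have hS : ∀ c ∈ D.oddComponents, Odd (S c).ncard := by
      intro c hc
      rw [Set.ncard_image_of_injective _ Subtype.val_injective]
      exact hc
    have hSu : ∀ c a, a ∈ S c → a ∉ u := by
      rintro c _ ⟨a, -, rfl⟩
      exact a.2.2
    have huniq : ∀ c c' a, a ∈ S c → a ∈ S c' → c = c' := by
      rintro c c' _ ⟨a, ha, rfl⟩ ⟨b, hb, hab⟩
      obtain rfl := Subtype.ext hab
      rw [SimpleGraph.ConnectedComponent.mem_supp_iff] at ha hb
      rw [← ha, ← hb]
    have hadj : ∀ i c, s i ∉ u → t i ∉ u → (s i ∈ S c ↔ t i ∈ S c) := by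
      intro i c hs ht
      have hsv : s i ∈ ((⊤ : G.Subgraph).deleteVerts u).verts := ⟨trivial, hs⟩
      have htv : t i ∈ ((⊤ : G.Subgraph).deleteVerts u).verts := ⟨trivial, ht⟩
      have hD : D.Adj ⟨s i, hsv⟩ ⟨t i, htv⟩ := by
        simp [D, hs, ht, hG i]
      have hmem : ∀ a (ha : a ∈ ((⊤ : G.Subgraph).deleteVerts u).verts),
          a ∈ S c ↔ (⟨a, ha⟩ : ((⊤ : G.Subgraph).deleteVerts u).verts) ∈ c.supp := by
        intro a ha
        constructor
        · rintro ⟨b, hb, rfl⟩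
          exact hb
        · exact fun h => ⟨_, h, rfl⟩
      rw [hmem _ hsv, hmem _ htv]
      exact c.mem_supp_congr_adj hD
    let O : Finset D.ConnectedComponent := D.oddComponents.toFinset
    have hOcard : D.oddComponents.ncard = O.card := Set.ncard_eq_toFinset_card' _
    -- an edge leaving a component ends in `u`, and only one component contains its other end
    have hcount : ∀ i, ∑ c ∈ O, (if (s i ∈ S c ↔ t i ∈ S c) then 0 else w i) ≤
        ∑ a ∈ u.toFinset, ((if s i = a then w i else 0) + if t i = a then w i else 0) := by
      intro i
      have hone : ∀ a : W, ∑ c ∈ O, (if a ∈ S c then w i else 0) ≤ w i := by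
        intro a
        by_cases h : ∃ c ∈ O, a ∈ S c
        · obtain ⟨c, hc, hac⟩ := h
          rw [Finset.sum_eq_single c (fun c' _ hne => if_neg fun h' => hne (huniq _ _ _ h' hac))
            (fun h => (h hc).elim), if_pos hac]
        · push Not at h
          rw [Finset.sum_eq_zero fun c hc => if_neg (h c hc)]
          exact hw₀ i
      rw [Finset.sum_add_distrib, Finset.sum_ite_eq, Finset.sum_ite_eq]
      simp only [Set.mem_toFinset]
      have hnot : ∀ a ∈ u, ∀ c, a ∉ S c := fun a ha c h => hSu c a h ha
      by_cases hs : s i ∈ u <;> by_cases ht : t i ∈ u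
      · simp [hnot _ hs, hnot _ ht, hs, ht, hw₀ i]
      · have := hone (t i)
        simp only [hnot _ hs, hs, ht, false_iff, ite_not, if_true, if_false, add_zero]
        exact this
      · have := hone (s i)
        simp only [hnot _ ht, hs, ht, iff_false, ite_not, if_true, if_false, zero_add]
        exact this
      · simp [hadj i _ hs ht, hs, ht]
    have h₁ : (O.card : ℚ) ≤ u.ncard := by
      calc (O.card : ℚ) = ∑ c ∈ O, 1 := by simp
        _ ≤ ∑ c ∈ O, ∑ i, (if (s i ∈ S c ↔ t i ∈ S c) then 0 else w i) :=
            Finset.sum_le_sum fun c hc => by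
              convert hcut (S c) (hS c (Set.mem_toFinset.1 hc))
        _ = ∑ i, ∑ c ∈ O, (if (s i ∈ S c ↔ t i ∈ S c) then 0 else w i) := Finset.sum_comm
        _ ≤ ∑ i, ∑ a ∈ u.toFinset, ((if s i = a then w i else 0) + if t i = a then w i else 0) :=
            Finset.sum_le_sum fun i _ => hcount i
        _ = ∑ a ∈ u.toFinset, 1 := by
            rw [Finset.sum_comm]
            exact Finset.sum_congr rfl fun a _ => hw a
        _ = u.ncard := by simp [Set.ncard_eq_toFinset_card']
    have h₂ : O.card ≤ u.ncard := by exact_mod_cast h₁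
    omega
  obtain ⟨M, hM⟩ := SimpleGraph.tutte.2 htutte
  rw [SimpleGraph.Subgraph.isPerfectMatching_iff] at hM
  let q : I → Sym2 W := fun i => s(s i, t i)
  let r : Set.range q → I := Set.rangeSplitting q
  have hq : ∀ i, q i ∈ Set.range q := Set.mem_range_self
  have hqr : ∀ z, q (r z) = z := Set.apply_rangeSplitting q
  -- parallel edges: exactly one edge is selected for each matched pair of vertices
  refine ⟨fun i => if q i ∈ M.edgeSet ∧ r ⟨q i, hq i⟩ = i then 1 else 0, fun a => ?_⟩
  obtain ⟨b, hab, hb⟩ := hM a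
  obtain ⟨hne, hr⟩ : a ≠ b ∧ s(a, b) ∈ Set.range q := M.adj_sub hab
  have hj : q (r ⟨s(a, b), hr⟩) = s(a, b) := hqr _
  generalize hjdef : r ⟨s(a, b), hr⟩ = j at hj
  have hsel : ∀ i, q i ∈ M.edgeSet → r ⟨q i, hq i⟩ = i → (s i = a ∨ t i = a) → i = j := by
    intro i hi hri hia
    have hqi : q i = s(a, b) := by
      rcases hia with h | h
      · have : M.Adj a (t i) := by simpa [q, h] using hi
        simp [q, h, hb _ this]
      · have : M.Adj a (s i) := by
          rw [← SimpleGraph.Subgraph.mem_edgeSet, Sym2.eq_swap]; simpa [q, h] using hi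
        simp [q, h, hb _ this, Sym2.eq_swap]
    rw [← hri, ← hjdef]
    congr 1
    exact Subtype.ext hqi
  have hjM : q j ∈ M.edgeSet ∧ r ⟨q j, hq j⟩ = j := by
    refine ⟨by rw [hj]; exact hab, ?_⟩
    conv_rhs => rw [← hjdef]
    congr 1
    exact Subtype.ext hj
  rw [Finset.sum_eq_single j]
  · beta_reduce
    rw [if_pos hjM]
    rcases Sym2.eq_iff.1 hj with ⟨h₁, h₂⟩ | ⟨h₁, h₂⟩
    · simp [h₁, h₂, hne.symm]
    · simp [h₁, h₂, hne.symm]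
  · intro i _ hij
    by_cases h : q i ∈ M.edgeSet ∧ r ⟨q i, hq i⟩ = i
    · have h' : ¬ (s i = a ∨ t i = a) := fun hia => hij (hsel i h.1 h.2 hia)
      push Not at h'
      simp [h'.1, h'.2]
    · simp [h]
  · simp

/-! ### The port gadget and its odd cuts -/

section Gadget

variable {V E : Type*} (inc : E × Bool → V) (N : V → ℕ)

/-- The first end of an edge of the port gadget. The gadget has a port for every half-edge `h` of
the given multigraph and `N v` internal vertices for every vertex `v`. Its edges are the edges `e`
of the multigraph, joining the two ports of `e`, and all pairs of a port and an internal vertex that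
belong to the same vertex. In a perfect matching, exactly `N v` ports at `v` are matched
internally. -/
def gadgetSrc : E ⊕ (Σ h : E × Bool, Fin (N (inc h))) → (E × Bool) ⊕ (Σ v, Fin (N v))
  | .inl e => .inl (e, false)
  | .inr p => .inl p.1

/-- The second end of an edge of the port gadget; see `gadgetSrc`. -/
def gadgetTgt : E ⊕ (Σ h : E × Bool, Fin (N (inc h))) → (E × Bool) ⊕ (Σ v, Fin (N v))
  | .inl e => .inl (e, true)
  | .inr p => .inr ⟨inc p.1, p.2⟩

theorem gadgetSrc_ne_gadgetTgt (i : E ⊕ (Σ h : E × Bool, Fin (N (inc h)))) :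
    gadgetSrc inc N i ≠ gadgetTgt inc N i := by
  cases i <;> simp [gadgetSrc, gadgetTgt]

variable [Fintype E] [DecidableEq ((E × Bool) ⊕ (Σ v, Fin (N v)))]
  {R : Type*} [AddCommMonoid R]

theorem gadget_degree_port (w : E ⊕ (Σ h : E × Bool, Fin (N (inc h))) → R) (h : E × Bool) :
    ∑ i, ((if gadgetSrc inc N i = .inl h then w i else 0) +
      if gadgetTgt inc N i = .inl h then w i else 0) =
    w (.inl h.1) + ∑ j, w (.inr ⟨h, j⟩) := by
  classical
  rw [Fintype.sum_sum_type, Fintype.sum_sigma]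
  congr 1
  · obtain ⟨e, b⟩ := h
    rw [Finset.sum_eq_single e]
    · cases b <;> simp [gadgetSrc, gadgetTgt]
    · intro e' _ he
      simp [gadgetSrc, gadgetTgt, he]
    · simp
  · rw [Finset.sum_eq_single h]
    · simp [gadgetSrc, gadgetTgt]
    · intro h' _ hh
      simp [gadgetSrc, gadgetTgt, hh]
    · simp

theorem gadget_degree_dummy [DecidableEq V] (w : E ⊕ (Σ h : E × Bool, Fin (N (inc h))) → R)
    (v : V) (j : Fin (N v)) :
    ∑ i, ((if gadgetSrc inc N i = .inr ⟨v, j⟩ then w i else 0) +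
      if gadgetTgt inc N i = .inr ⟨v, j⟩ then w i else 0) =
    ∑ h, if hv : inc h = v then w (.inr ⟨h, hv ▸ j⟩) else 0 := by
  classical
  rw [Fintype.sum_sum_type, Fintype.sum_sigma]
  rw [Finset.sum_eq_zero (fun e _ => by simp [gadgetSrc, gadgetTgt]), zero_add]
  refine Finset.sum_congr rfl fun h _ => ?_
  by_cases hv : inc h = v
  · subst hv
    simp [gadgetSrc, gadgetTgt]
  · simp [gadgetSrc, gadgetTgt, hv]

end Gadget

theorem ncard_sum_sigma {α : Type*} {β : α → Type*} {γ : Type*} [Fintype α] [∀ a, Fintype (β a)]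
    [Fintype γ] (C : Set (γ ⊕ (Σ a, β a))) : open Classical in
    C.ncard = ∑ x, (if Sum.inl x ∈ C then 1 else 0) +
      ∑ a, ∑ b : β a, if Sum.inr ⟨a, b⟩ ∈ C then 1 else 0 := by
  classical
  rw [← Fintype.sum_sigma', ← Fintype.sum_sum_type (fun x => if x ∈ C then 1 else 0)]
  rw [Finset.sum_boole, Nat.cast_id, Set.ncard_eq_toFinset_card', Set.filter_mem_univ_eq_toFinset]

section Cut
variable {V E : Type*} [Fintype V] [DecidableEq V] [Fintype E]

open Classical in
/-- The cut of a vertex set of the port gadget, in thirds, when the set contains all or none of the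
internal vertices at each `v`: `P` is its set of ports and `A` the set of `v` whose internal
vertices it contains. The `N v` internal vertices then act as a single vertex of degree `3 * N v`,
all weights are integers, and the ports have degree `3`, so the cut has the parity of the set. It
is therefore odd, and it is not `1`, since then exactly one edge would cross `A`. -/
theorem three_le_gadget_cut {inc : E × Bool → V} {y : E → ℕ} (hy : ∀ e, y e = 1 ∨ y e = 2)
    {N : V → ℕ} (hN : ∀ v, ∑ h : E × Bool, (if inc h = v then y h.1 else 0) = 3 * N v)
    (hcut : ∀ (A : Set V) e₀, ¬ ∀ e, (inc (e, false) ∈ A ↔ inc (e, true) ∈ A) ↔ e ≠ e₀)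
    (P : Set (E × Bool)) (A : Set V)
    (hodd : Odd (∑ h, (if h ∈ P then 1 else 0) + ∑ v, N v * if v ∈ A then 1 else 0)) :
    3 ≤ ∑ e, (if ((e, false) ∈ P ↔ (e, true) ∈ P) then 0 else 3 - y e) +
      ∑ h : E × Bool, if (h ∈ P ↔ inc h ∈ A) then 0 else y h.1 := by
  set p : E × Bool → ℕ := fun h => if h ∈ P then 1 else 0 with hp
  set c : V → ℕ := fun v => if v ∈ A then 1 else 0 with hc
  set κ : E → ℕ := fun e => (if ((e, false) ∈ P ↔ (e, true) ∈ P) then 0 else 3 - y e) +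
    ((if ((e, true) ∈ P ↔ inc (e, true) ∈ A) then 0 else y e) +
    if ((e, false) ∈ P ↔ inc (e, false) ∈ A) then 0 else y e) with hκ
  have hsum : ∑ e, (if ((e, false) ∈ P ↔ (e, true) ∈ P) then 0 else 3 - y e) +
      ∑ h : E × Bool, (if (h ∈ P ↔ inc h ∈ A) then 0 else y h.1) = ∑ e, κ e := by
    simp only [Fintype.sum_prod_type, Fintype.sum_bool, ← Finset.sum_add_distrib, hκ]
  rw [hsum]
  have hpar : ∀ e, Even (κ e + (p (e, true) + p (e, false) +
      (y e * c (inc (e, true)) + y e * c (inc (e, false))))) := by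
    intro e
    simp only [hκ, hp, hc]
    rcases hy e with h | h <;> rw [h] <;>
    by_cases h₁ : (e, false) ∈ P <;> by_cases h₂ : (e, true) ∈ P <;>
    by_cases h₃ : inc (e, false) ∈ A <;> by_cases h₄ : inc (e, true) ∈ A <;>
    simp only [h₁, h₂, h₃, h₄] <;> decide
  have hpar' : Even (∑ e, κ e + (∑ h, p h + 3 * ∑ v, N v * c v)) := by
    have h₁ : 3 * ∑ v, N v * c v = ∑ h : E × Bool, y h.1 * c (inc h) := by
      rw [Finset.mul_sum]
      calc ∑ v, 3 * (N v * c v)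
          = ∑ v, ∑ h : E × Bool, (if inc h = v then y h.1 * c v else 0) := by
            refine Finset.sum_congr rfl fun v _ => ?_
            rw [← mul_assoc, ← hN, Finset.sum_mul]
            exact Finset.sum_congr rfl fun h _ => by split_ifs <;> simp
        _ = _ := by
            rw [Finset.sum_comm]
            exact Finset.sum_congr rfl fun h _ => by simp
    rw [h₁]
    simp only [Fintype.sum_prod_type, Fintype.sum_bool, ← Finset.sum_add_distrib]
    exact Finset.even_sum _ fun e _ => hpar e
  have hκodd : Odd (∑ e, κ e) := by
    change Odd (∑ h, p h + ∑ v, N v * c v) at hodd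
    rw [Nat.even_iff] at hpar'
    rw [Nat.odd_iff] at hodd ⊢
    omega
  by_contra! hlt
  have hone : ∑ e, κ e = 1 := by
    rw [Nat.odd_iff] at hκodd
    omega
  obtain ⟨e₀, he₀, hothers⟩ : ∃ e₀, κ e₀ = 1 ∧ ∀ e, e ≠ e₀ → κ e = 0 := by
    have hpos : ∃ e₀, κ e₀ ≠ 0 := by
      by_contra! h
      simp [h] at hone
    obtain ⟨e₀, he₀⟩ := hpos
    have := Finset.add_sum_erase Finset.univ κ (Finset.mem_univ e₀)
    have hzero : ∑ e ∈ Finset.univ.erase e₀, κ e = 0 := by omega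
    rw [Finset.sum_eq_zero_iff] at hzero
    exact ⟨e₀, by omega, fun e he => hzero e (by simp [he])⟩
  have hcross : ∀ e, (κ e = 0 → (inc (e, false) ∈ A ↔ inc (e, true) ∈ A)) ∧
      (κ e = 1 → ¬ (inc (e, false) ∈ A ↔ inc (e, true) ∈ A)) := by
    intro e
    simp only [hκ]
    rcases hy e with h | h <;> rw [h] <;>
    by_cases h₁ : (e, false) ∈ P <;> by_cases h₂ : (e, true) ∈ P <;>
    by_cases h₃ : inc (e, false) ∈ A <;> by_cases h₄ : inc (e, true) ∈ A <;>
    simp [h₁, h₂, h₃, h₄]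
  refine hcut A e₀ fun e => ⟨?_, fun he => (hcross e).1 (hothers e he)⟩
  rintro h rfl
  exact (hcross e).2 he₀ h
end Cut

/-! ### Factors of bridgeless weighted multigraphs -/

section Factor
variable {V E : Type*} [Fintype V] [DecidableEq V] [Fintype E]

/-- A multigraph without one-edge cuts, with edge weights `y ∈ {1, 2}` whose sum at each vertex `v`
is `3 * N v`, has a spanning subgraph `k` of degree `N v` at each `v`. In the cubic case with `y = 1`
this is Petersen's theorem. In the port gadget, an edge `e` gets weight `(3 - y e) / 3`, and the
edges from a port of `e` to the internal vertices share the remaining `y e / 3` equally. -/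
theorem exists_factor_of_no_bridge {inc : E × Bool → V} {y : E → ℕ} (hy : ∀ e, y e = 1 ∨ y e = 2)
    {N : V → ℕ} (hN : ∀ v, ∑ h : E × Bool, (if inc h = v then y h.1 else 0) = 3 * N v)
    (hcut : ∀ (A : Set V) e₀, ¬ ∀ e, (inc (e, false) ∈ A ↔ inc (e, true) ∈ A) ↔ e ≠ e₀) :
    ∃ k : E → ℕ, (∀ e, k e ≤ 1) ∧
      ∀ v, ∑ h : E × Bool, (if inc h = v then k h.1 else 0) = N v := by
  classical
  have hypos : ∀ e, 0 < y e := fun e => by rcases hy e with h | h <;> omega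
  have hyle : ∀ e, y e ≤ 3 := fun e => by rcases hy e with h | h <;> omega
  have hNpos : ∀ h, N (inc h) ≠ 0 := by
    intro h h₀
    have h₁ := hN (inc h)
    rw [h₀, mul_zero, Finset.sum_eq_zero_iff] at h₁
    have := h₁ h (Finset.mem_univ h)
    rw [if_pos rfl] at this
    exact (hypos h.1).ne' this
  let w : E ⊕ (Σ h : E × Bool, Fin (N (inc h))) → ℚ
    | .inl e => (3 - y e) / 3
    | .inr p => y p.1.1 / (3 * N (inc p.1))
  have hw₀ : ∀ i, 0 ≤ w i := by
    rintro (e | p)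
    · have : (y e : ℚ) ≤ 3 := by exact_mod_cast hyle e
      simp only [w]
      linarith
    · simp only [w]
      positivity
  have hwv : ∀ v, N v ≠ 0 →
      ∑ h : E × Bool, (if inc h = v then (y h.1 : ℚ) / (3 * N (inc h)) else 0) = 1 := by
    intro v hv
    have h₁ : ∑ h : E × Bool, (if inc h = v then (y h.1 : ℚ) else 0) = 3 * N v := by
      exact_mod_cast hN v
    have h₂ : ∀ h : E × Bool, (if inc h = v then (y h.1 : ℚ) / (3 * N (inc h)) else 0) =
        (if inc h = v then (y h.1 : ℚ) else 0) / (3 * N v) := by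
      intro h
      split_ifs with hh
      · rw [hh]
      · simp
    rw [Finset.sum_congr rfl fun h _ => h₂ h, ← Finset.sum_div, h₁]
    have : (N v : ℚ) ≠ 0 := by exact_mod_cast hv
    field_simp
  have hw : ∀ a, ∑ i, ((if gadgetSrc inc N i = a then w i else 0) +
      if gadgetTgt inc N i = a then w i else 0) = 1 := by
    rintro (h | ⟨v, j⟩)
    · rw [gadget_degree_port]
      have : (N (inc h) : ℚ) ≠ 0 := by exact_mod_cast hNpos h
      simp only [w, Finset.sum_const, Finset.card_univ, Fintype.card_fin, nsmul_eq_mul]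
      field_simp
      ring
    · rw [gadget_degree_dummy]
      exact hwv v j.pos.ne'
  have hwcut : ∀ C : Set ((E × Bool) ⊕ (Σ v, Fin (N v))), Odd C.ncard →
      1 ≤ ∑ i, if (gadgetSrc inc N i ∈ C ↔ gadgetTgt inc N i ∈ C) then 0 else w i := by
    intro C hC
    by_cases hsplit : ∃ v, ∃ i j : Fin (N v), .inr ⟨v, i⟩ ∈ C ∧ .inr ⟨v, j⟩ ∉ C
    · -- every port at `v` is separated from one of the internal vertices at `v`
      obtain ⟨v, i, j, hi, hj⟩ := hsplit
      rw [← hwv v i.pos.ne', Fintype.sum_sum_type, Fintype.sum_sigma]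
      refine le_add_of_nonneg_of_le (Finset.sum_nonneg fun e _ => ?_)
        (Finset.sum_le_sum fun h _ => ?_)
      · split_ifs
        exacts [le_rfl, hw₀ (.inl e)]
      · have hnn : ∀ x ∈ Finset.univ, 0 ≤ (if (gadgetSrc inc N (.inr ⟨h, x⟩) ∈ C ↔
            gadgetTgt inc N (.inr ⟨h, x⟩) ∈ C) then 0 else w (.inr ⟨h, x⟩)) := by
          intro x _
          split_ifs
          exacts [le_rfl, hw₀ (.inr ⟨h, x⟩)]
        by_cases hv : inc h = v
        · subst hv
          rw [if_pos rfl]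
          by_cases hh : Sum.inl h ∈ C
          · refine le_trans ?_ (Finset.single_le_sum hnn (Finset.mem_univ j))
            simp [gadgetSrc, gadgetTgt, hh, hj, w]
          · refine le_trans ?_ (Finset.single_le_sum hnn (Finset.mem_univ i))
            simp [gadgetSrc, gadgetTgt, hh, hi, w]
        · rw [if_neg hv]
          exact Finset.sum_nonneg hnn
    · push Not at hsplit
      let P : Set (E × Bool) := {h | .inl h ∈ C}
      let A : Set V := {v | ∃ i : Fin (N v), .inr ⟨v, i⟩ ∈ C}
      have hA : ∀ v (i : Fin (N v)), .inr ⟨v, i⟩ ∈ C ↔ v ∈ A :=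
        fun v i => ⟨fun h => ⟨i, h⟩, fun ⟨j, hj⟩ => hsplit v j i hj⟩
      have hodd : Odd (∑ h, (if h ∈ P then 1 else 0) + ∑ v, N v * if v ∈ A then 1 else 0) := by
        convert hC using 1
        rw [ncard_sum_sigma]
        simp [hA, P]
      have h3 := three_le_gadget_cut hy hN hcut P A (by convert hodd)
      have h3' : (3 : ℚ) ≤ ∑ e, (if ((e, false) ∈ P ↔ (e, true) ∈ P) then 0 else 3 - (y e : ℚ)) +
          ∑ h : E × Bool, if (h ∈ P ↔ inc h ∈ A) then 0 else (y h.1 : ℚ) := by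
        have := (Nat.cast_le (α := ℚ)).2 h3
        push_cast [Nat.cast_sub (hyle _)] at this
        exact this
      rw [Fintype.sum_sum_type, Fintype.sum_sigma]
      have h₁ : ∀ e : E, (if (gadgetSrc inc N (.inl e) ∈ C ↔ gadgetTgt inc N (.inl e) ∈ C) then 0
          else w (.inl e)) =
          (if ((e, false) ∈ P ↔ (e, true) ∈ P) then 0 else 3 - (y e : ℚ)) / 3 := by
        intro e
        rw [ite_div, zero_div]
        rfl
      have h₂ : ∀ h : E × Bool, ∑ j : Fin (N (inc h)), (if (gadgetSrc inc N (.inr ⟨h, j⟩) ∈ C ↔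
          gadgetTgt inc N (.inr ⟨h, j⟩) ∈ C) then 0 else w (.inr ⟨h, j⟩)) =
          (if (h ∈ P ↔ inc h ∈ A) then 0 else (y h.1 : ℚ)) / 3 := by
        intro h
        have hne : (N (inc h) : ℚ) ≠ 0 := by exact_mod_cast hNpos h
        have hiff : ∀ j : Fin (N (inc h)), (gadgetSrc inc N (.inr ⟨h, j⟩) ∈ C ↔
            gadgetTgt inc N (.inr ⟨h, j⟩) ∈ C) ↔ (h ∈ P ↔ inc h ∈ A) := fun j =>
          iff_congr Iff.rfl (hA _ _)
        simp only [hiff, w, Finset.sum_const, Finset.card_univ, Fintype.card_fin, nsmul_eq_mul]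
        split_ifs
        · simp
        · field_simp
      rw [Finset.sum_congr rfl fun e _ => h₁ e, Finset.sum_congr rfl fun h _ => h₂ h,
        ← Finset.sum_div, ← Finset.sum_div, ← add_div, le_div_iff₀ (by norm_num)]
      linarith
  obtain ⟨m, hm⟩ := exists_exactCover_of_fractional (gadgetSrc inc N) (gadgetTgt inc N)
    (gadgetSrc_ne_gadgetTgt inc N) w hw₀ hw fun C hC => by convert hwcut C hC
  have hport : ∀ h : E × Bool, m (.inl h.1) + ∑ j, m (.inr ⟨h, j⟩) = 1 := fun h => by
    rw [← gadget_degree_port, hm]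
  -- an edge belongs to the factor when its ports are matched internally
  refine ⟨fun e => 1 - m (.inl e), fun e => Nat.sub_le _ _, fun v => ?_⟩
  calc ∑ h : E × Bool, (if inc h = v then 1 - m (.inl h.1) else 0)
      = ∑ h : E × Bool, ∑ j : Fin (N v), (if hv : inc h = v then m (.inr ⟨h, hv ▸ j⟩) else 0) := by
        refine Finset.sum_congr rfl fun h _ => ?_
        by_cases hv : inc h = v
        · subst hv
          have := hport h
          simp only [if_true, dite_true]
          omega
        · simp [hv]
    _ = ∑ j : Fin (N v), 1 := by
        rw [Finset.sum_comm]
        refine Finset.sum_congr rfl fun j _ => ?_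
        rw [← gadget_degree_dummy, hm]
    _ = N v := by simp

end Factor

/-! ### Factors with labelled half-edges -/

theorem Fintype.sum_dite_eq_sum_subtype {α R : Type*} [Fintype α] [AddCommMonoid R] (p : α → Prop)
    [DecidablePred p] [Fintype {a // p a}] (f : ∀ a, p a → R) :
    ∑ a, (if h : p a then f a h else 0) = ∑ x : {a // p a}, f x.1 x.2 := by
  rw [Finset.sum_dite, Finset.sum_const_zero, add_zero]
  exact Finset.sum_bij' (fun x _ => ⟨x.1, (Finset.mem_filter.1 x.2).2⟩)
    (fun x _ => ⟨x.1, Finset.mem_filter.2 ⟨Finset.mem_univ _, x.2⟩⟩)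
    (by simp) (by simp) (by simp) (by simp) (by simp)

section Labelled
variable {V E : Type*} [Fintype V] [DecidableEq V] [Fintype E]

/-- If the half-edges of a multigraph without one-edge cuts carry labels `±1` whose sum at each
vertex `v` is `3 * d v`, then some set `k` of edges has label sum `d v` at each `v`. The labels of
the two halves of an edge are unrelated. A half-edge with label `-1` gets weight `2 = -1 + 3` and
contributes to the factor exactly when its edge is not in `k`; an edge with opposite labels is
subdivided, with one edge of the factor at the new vertex, so that exactly one of its two parts lies
in the factor. -/
theorem exists_labelled_factor {inc : E × Bool → V} (s : E × Bool → ℤˣ) {d : V → ℤ}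
    (hd : ∀ v, ∑ h, (if inc h = v then (s h : ℤ) else 0) = 3 * d v)
    (hcut : ∀ (A : Set V) e₀, ¬ ∀ e, (inc (e, false) ∈ A ↔ inc (e, true) ∈ A) ↔ e ≠ e₀) :
    ∃ k : E → ℤ, (∀ e, k e = 0 ∨ k e = 1) ∧
      ∀ v, ∑ h, (if inc h = v then k h.1 * s h else 0) = d v := by
  classical
  let M := {e : E // s (e, false) ≠ s (e, true)}
  let inc' : (E ⊕ M) × Bool → V ⊕ M
    | (.inl e, false) => .inl (inc (e, false))
    | (.inl e, true) =>
      if h : s (e, false) ≠ s (e, true) then .inr ⟨e, h⟩ else .inl (inc (e, true))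
    | (.inr m, false) => .inr m
    | (.inr m, true) => .inl (inc (m.1, true))
  -- the part of a subdivided edge that contains a given half-edge
  let part : E × Bool → E ⊕ M
    | (e, false) => .inl e
    | (e, true) => if h : s (e, false) ≠ s (e, true) then .inr ⟨e, h⟩ else .inl e
  have hsum_inl : ∀ (w : E ⊕ M → ℕ) (v : V),
      ∑ h, (if inc' h = .inl v then w h.1 else 0) =
      ∑ h, (if inc h = v then w (part h) else 0) := by
    intro w v
    simp only [Fintype.sum_prod_type, Fintype.sum_bool, Fintype.sum_sum_type]
    have h₁ : ∑ m : M, ((if inc' (.inr m, true) = .inl v then w (.inr m) else 0) +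
        (if inc' (.inr m, false) = .inl v then w (.inr m) else 0)) =
        ∑ e, if h : s (e, false) ≠ s (e, true) then
          (if inc (e, true) = v then w (.inr ⟨e, h⟩) else 0) else 0 := by
      rw [Fintype.sum_dite_eq_sum_subtype]
      simp [inc', M]
    rw [h₁, ← Finset.sum_add_distrib]
    refine Finset.sum_congr rfl fun e _ => ?_
    by_cases h : s (e, false) ≠ s (e, true)
    · simp [inc', part, h, add_comm]
    · push Not at h
      simp [inc', part, h]
  have hsum_inr : ∀ (w : E ⊕ M → ℕ) (m : M),
      ∑ h, (if inc' h = .inr m then w h.1 else 0) = w (.inl m.1) + w (.inr m) := by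
    intro w m
    simp only [Fintype.sum_prod_type, Fintype.sum_bool, Fintype.sum_sum_type]
    congr 1
    · rw [Finset.sum_eq_single m.1]
      · simp [inc', m.2]
      · intro e _ he
        by_cases h : s (e, false) ≠ s (e, true)
        · have : (⟨e, h⟩ : M) ≠ m := fun h' => he (congrArg Subtype.val h')
          simp [inc', h, this]
        · push Not at h
          simp [inc', h]
      · simp
    · rw [Finset.sum_eq_single m (fun x _ hx => by simp [inc', hx]) (by simp)]
      simp [inc']
  -- `u` is the weight of a half-edge with a given label, `β` indicates the label `-1`
  let u : ℤˣ → ℕ := fun z => if z = 1 then 1 else 2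
  let β : ℤˣ → ℤ := fun z => if z = 1 then 0 else 1
  have hu : ∀ z, (u z : ℤ) = z + 3 * β z := by
    intro z
    rcases Int.units_eq_one_or z with rfl | rfl <;> decide
  -- on an unsubdivided edge both labels agree, so the label of either half may be used
  let y : E ⊕ M → ℕ := Sum.elim (fun e => u (s (e, false))) (fun m => u (s (m.1, true)))
  have hy : ∀ e, y e = 1 ∨ y e = 2 := by
    have hu' : ∀ z, u z = 1 ∨ u z = 2 := fun z => ite_eq_or_eq _ _ _
    rintro (e | m)
    exacts [hu' _, hu' _]
  have hypart : ∀ h, y (part h) = u (s h) := by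
    rintro ⟨e, _ | _⟩
    · rfl
    · by_cases h : s (e, false) = s (e, true)
      · simp [part, y, h]
      · simp [part, y, h]
  let D : V → ℤ := fun v => d v + ∑ h, if inc h = v then β (s h) else 0
  have hD : ∀ v, ((∑ h, if inc h = v then u (s h) else 0 : ℕ) : ℤ) = 3 * D v := by
    intro v
    simp only [D]
    rw [mul_add, ← hd, Finset.mul_sum, ← Finset.sum_add_distrib]
    push_cast
    refine Finset.sum_congr rfl fun h _ => ?_
    split_ifs
    · exact hu _
    · simp
  have hD₀ : ∀ v, 0 ≤ D v := fun v => by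
    have := hD v
    omega
  obtain ⟨k, hk, hkN⟩ := exists_factor_of_no_bridge (inc := inc') hy
    (N := Sum.elim (fun v => (D v).toNat) (fun _ => 1)) (by
      rintro (v | m)
      · rw [hsum_inl]
        simp only [hypart, Sum.elim_inl]
        have := hD v
        have := hD₀ v
        omega
      · rw [hsum_inr]
        have := m.2
        simp only [y, u, Sum.elim_inl, Sum.elim_inr]
        rcases Int.units_eq_one_or (s (m.1, false)) with h | h <;>
        rcases Int.units_eq_one_or (s (m.1, true)) with h' | h' <;>
        simp_all) (by
      intro A e₀ h
      refine hcut {v | .inl v ∈ A} (Sum.elim id Subtype.val e₀) fun e => ?_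
      have h₁ := h (.inl e)
      by_cases he : s (e, false) ≠ s (e, true)
      · have h₂ := h (.inr ⟨e, he⟩)
        simp only [inc', he, dite_true, not_false_eq_true, ne_eq] at h₁ h₂
        rcases e₀ with e' | m
        · simp only [Sum.inl.injEq, reduceCtorEq, not_false_eq_true, iff_true] at h₁ h₂
          simp only [Set.mem_ofPred_eq, Sum.elim_inl, id]
          tauto
        · have h₃ : (⟨e, he⟩ : M) = m ↔ e = m.1 := Subtype.ext_iff
          simp only [Sum.inr.injEq, reduceCtorEq, not_false_eq_true, iff_true, h₃] at h₁ h₂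
          simp only [Set.mem_ofPred_eq, Sum.elim_inr]
          tauto
      · simp only [inc', he, dite_false] at h₁
        rcases e₀ with e' | m
        · simpa using h₁
        · have : e ≠ m.1 := by
            rintro rfl
            exact he m.2
          simpa [this] using h₁)
  have hkm : ∀ m : M, k (.inl m.1) + k (.inr m) = 1 := fun m => by
    rw [← hsum_inr, hkN, Sum.elim_inr]
  refine ⟨fun e => if s (e, false) = 1 then k (.inl e) else 1 - k (.inl e), fun e => ?_,
    fun v => ?_⟩
  · have := hk (.inl e)
    dsimp only
    split_ifs <;> omega
  · have hpart : ∀ h : E × Bool, ((if s (h.1, false) = 1 then (k (.inl h.1) : ℤ)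
        else 1 - k (.inl h.1)) * s h : ℤ) = k (part h) - β (s h) := by
      rintro ⟨e, _ | _⟩
      · rcases Int.units_eq_one_or (s (e, false)) with h | h <;> simp [h, part, β]
      · by_cases he : s (e, false) ≠ s (e, true)
        · have := hkm ⟨e, he⟩
          rcases Int.units_eq_one_or (s (e, false)) with h | h <;>
          rcases Int.units_eq_one_or (s (e, true)) with h' | h' <;>
          simp [part, β, h, h'] at this he ⊢ <;> omega
        · push Not at he
          rcases Int.units_eq_one_or (s (e, true)) with h | h <;> simp [he, h, part, β]
    have hv : ((∑ h, if inc h = v then k (part h) else 0 : ℕ) : ℤ) = D v := by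
      rw [← hsum_inl, hkN, Sum.elim_inl, Int.toNat_of_nonneg (hD₀ v)]
    push_cast at hv
    have : ∀ h : E × Bool, (if inc h = v then ((if s (h.1, false) = 1 then (k (.inl h.1) : ℤ)
        else 1 - k (.inl h.1)) * s h : ℤ) else 0) =
        (if inc h = v then (k (part h) : ℤ) else 0) - if inc h = v then β (s h) else 0 := by
      intro h
      rw [hpart]
      split_ifs <;> simp
    rw [Finset.sum_congr rfl fun h _ => this h, Finset.sum_sub_distrib, hv]
    simp [D]

end Labelled

/-! ### Bridges and flows -/

/-- The only edge that joins a vertex set `A` to its complement is a bridge. -/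
theorem SignedGraph.isBridge_of_forall_iff {V E : Type*} [Finite V] (G : SignedGraph V E)
    (A : Set V) (e₀ : E)
    (h : ∀ e, (G.inc (e, false) ∈ A ↔ G.inc (e, true) ∈ A) ↔ e ≠ e₀) :
    G.toGraph.IsBridge e₀ := by
  refine ⟨Set.mem_univ _, ?_⟩
  let φ : (Quot fun x y : V(G.toGraph.deleteEdges {e₀}) => (G.toGraph.deleteEdges {e₀}).Adj x y) →
      Quot fun x y : V(G.toGraph) => G.toGraph.Adj x y :=
    Quot.map (fun x => ⟨x.1, Set.mem_univ _⟩) fun x y ⟨e, he⟩ => ⟨e, he.1⟩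
  have hφ : Function.Surjective φ := by
    rintro ⟨x⟩
    exact ⟨Quot.mk _ ⟨x.1, Set.mem_univ _⟩, rfl⟩
  have hφ' : ¬ Function.Injective φ := by
    intro hinj
    have h₁ : φ (Quot.mk _ ⟨G.inc (e₀, false), Set.mem_univ _⟩) =
        φ (Quot.mk _ ⟨G.inc (e₀, true), Set.mem_univ _⟩) := Quot.sound ⟨e₀, rfl⟩
    let ψ : (Quot fun x y : V(G.toGraph.deleteEdges {e₀}) =>
        (G.toGraph.deleteEdges {e₀}).Adj x y) → Prop :=
      Quot.lift (fun x => x.1 ∈ A) (by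
        rintro x y ⟨e, he, hne⟩
        have hA := (h e).2 hne
        rcases Sym2.eq_iff.1 he with ⟨hx, hy⟩ | ⟨hx, hy⟩
        · rw [← hx, ← hy]
          exact propext hA
        · rw [← hx, ← hy]
          exact propext hA.symm)
    have h₂ := congrArg ψ (hinj h₁)
    exact (h e₀).1 (iff_of_eq h₂) rfl
  have : Finite V(G.toGraph) := Subtype.finite
  have : Finite V(G.toGraph.deleteEdges {e₀}) := Subtype.finite
  by_contra hle
  exact hφ' (hφ.bijective_of_nat_card_le (not_lt.1 hle)).1

theorem theorem3 {V E : Type*} [Fintype V] [DecidableEq V] [Fintype E]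
    (G : SignedGraph V E) (hG : G.toGraph.IsBridgeless)
    (τ : E × Bool → ℤˣ) (hτ : G.IsOrientation τ)
    (f₁ : E → ℤ) (hf₁ : G.IsModuloFlow τ 3 f₁) :
    ∃ f₂ : E → ℤ, G.IsIntegerFlow τ 4 f₂ ∧
      Function.support f₁ ⊆ {e | f₂ e = 1 ∨ f₂ e = -1 ∨ f₂ e = 2 ∨ f₂ e = -2} := by
  classical
  -- `Z` indexes the second copies of the edges on which `f₁` vanishes
  let Z := {e : E // f₁ e = 0}
  let base : E ⊕ Z → E := Sum.elim id Subtype.val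
  -- the sum over the copies of an edge
  let total : (E ⊕ Z → ℤ) → E → ℤ :=
    fun F e => F (.inl e) + if h : f₁ e = 0 then F (.inr ⟨e, h⟩) else 0
  have hsum : ∀ (F : E ⊕ Z → ℤ) (v : V),
      ∑ h : (E ⊕ Z) × Bool, (if G.inc (base h.1, h.2) = v then F h.1 * τ (base h.1, h.2) else 0) =
        G.boundary τ (total F) v := by
    intro F v
    rw [SignedGraph.boundary, Finset.sum_filter]
    simp only [Fintype.sum_prod_type, Fintype.sum_bool, Fintype.sum_sum_type]
    have h₁ := Fintype.sum_dite_eq_sum_subtype (fun e => f₁ e = 0) fun e h =>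
      (if G.inc (e, true) = v then F (.inr ⟨e, h⟩) * τ (e, true) else 0) +
        (if G.inc (e, false) = v then F (.inr ⟨e, h⟩) * τ (e, false) else 0)
    refine (congrArg _ h₁.symm).trans ?_
    rw [← Finset.sum_add_distrib]
    refine Finset.sum_congr rfl fun e _ => ?_
    simp only [total, base, Sum.elim_inl, id]
    by_cases h : f₁ e = 0 <;> by_cases ht : G.inc (e, true) = v <;>
    by_cases hf : G.inc (e, false) = v <;> simp [h, ht, hf] <;> ring
  -- `f₁` reduced to `±1` modulo `3`; the two copies of a zero edge receive `1` and `-1`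
  let g : E ⊕ Z → ℤˣ := Sum.elim (fun e => if f₁ e % 3 = 2 then -1 else 1) fun _ => -1
  have hg : ∀ e, total (fun x => (g x : ℤ)) e ≡ f₁ e [ZMOD 3] := by
    intro e
    have := abs_le.1 (hf₁.1 e)
    simp only [total, g, Sum.elim_inl, Sum.elim_inr, Int.ModEq]
    split_ifs <;> simp <;> omega
  have hdvd : ∀ v, (3 : ℤ) ∣ G.boundary τ (total fun x => (g x : ℤ)) v := by
    intro v
    refine Int.modEq_zero_iff_dvd.1 (Int.ModEq.trans ?_ (hf₁.2 v))
    exact Int.ModEq.sum fun h _ => (hg h.1).mul_right _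
  choose d hd using hdvd
  obtain ⟨k, hk, hkd⟩ := exists_labelled_factor
    (inc := fun h : (E ⊕ Z) × Bool => G.inc (base h.1, h.2))
    (fun h => g h.1 * τ (base h.1, h.2)) (d := d)
    (fun v => by
      rw [← hd]
      simpa using hsum (fun x => (g x : ℤ)) v)
    (by
      intro A e₀ h
      rcases e₀ with e₀ | z
      · by_cases hz : f₁ e₀ = 0
        · exact (h (.inl e₀)).1 ((h (.inr ⟨e₀, hz⟩)).2 (by simp)) rfl
        · refine hG e₀ (G.isBridge_of_forall_iff A e₀ fun e => ?_)
          simpa [base] using h (.inl e)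
      · exact (h (.inr z)).1 ((h (.inl z.1)).2 (by simp)) rfl)
  have hkd' : ∀ v, G.boundary τ (total fun x => k x * g x) v = d v := by
    intro v
    rw [← hkd]
    simpa [mul_assoc] using (hsum (fun x => k x * g x) v).symm
  -- a copy with value `g` keeps it or changes it to `-2 * g`; on a zero edge the values `1` or `-2`
  -- and `-1` or `2` of the copies add up to `0`, `3` or `-3`
  refine ⟨fun e => total (fun x => (g x : ℤ)) e - 3 * total (fun x => k x * g x) e,
    ⟨fun e => ?_, fun v => ?_⟩, fun e he => ?_⟩
  · have h₁ := hk (.inl e)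
    have hu := Int.units_eq_one_or (g (.inl e))
    by_cases h : f₁ e = 0
    · have h₂ := hk (.inr ⟨e, h⟩)
      simp only [total, h, dite_true, g, Sum.elim_inl, Sum.elim_inr]
      rcases h₁ with h₁ | h₁ <;> rcases h₂ with h₂ | h₂ <;> simp [h₁, h₂]
    · simp only [total, h, dite_false, add_zero]
      rcases h₁ with h₁ | h₁ <;> rcases hu with hu | hu <;> simp [h₁, hu]
  · have h₁ : G.boundary τ (fun e => total (fun x => (g x : ℤ)) e -
        3 * total (fun x => k x * g x) e) v =
        G.boundary τ (total fun x => (g x : ℤ)) v -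
          3 * G.boundary τ (total fun x => k x * g x) v := by
      simp only [SignedGraph.boundary, Finset.mul_sum, ← Finset.sum_sub_distrib]
      exact Finset.sum_congr rfl fun h _ => by ring
    rw [h₁, hd, hkd', sub_self]
  · have h₁ := hk (.inl e)
    have hu := Int.units_eq_one_or (g (.inl e))
    have h : f₁ e ≠ 0 := he
    simp only [total, h, dite_false, add_zero, Set.mem_ofPred_eq]
    rcases h₁ with h₁ | h₁ <;> rcases hu with hu | hu <;> simp [h₁, hu]
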